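/- **Setting.** Let $\mathbf{Top}$ be one of the following three categories: all topological spaces; compactly generated spaces (those with the final topology with respect to maps from compact Hausdorff spaces); $\Delta$-generated spaces (those with the final topology with respect to maps from topological simplices, equivalently from Euclidean spaces). Subspaces and mapping spaces are formed in $\mathbf{Top}$, that is, the usual subspace and compact-open topologies are replaced by their coreflections into $\mathbf{Top}$ (no change in the first case). Let $P$ be a poset, with the Alexandrov topology whose closed sets are the downward closed sets. A *$P$-stratified space* $\mathcal X$ is a space $X\in\mathbf{Top}$ with a continuous map $s\colon X\to P$; put $X_p=s^{-1}(p)$ and $X_{\le p}=s^{-1}(\{q\in P\mid q\le p\})$. Subspaces of $X$ carry the restricted stratification. A continuous map between stratified spaces is *stratum-preserving* if it commutes with the maps to $P$. A *flag* of $P$ is a sequence $\mathcal J=[p_0\le\dots\le p_n]$, $n\ge 0$, of elements of $P$; it is *regular* if the $p_i$ are pairwise distinct. The stratified simplex $|\Delta^{\mathcal J}|_s$ is the topological simplex $|\Delta^n|\subset\mathbb R^{n+1}$ with the stratification $x\mapsto\sup\{p_i\mid x_i>0\}$. For a flag $\mathcal I$, the *homotopy link* $\mathrm{HoLink}_{\mathcal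 I}(\mathcal X)$ is the set of stratum-preserving maps $|\Delta^{\mathcal I}|_s\to\mathcal X$, with the subspace topology (in $\mathbf{Top}$) of the compact-open topology; it is functorial in stratum-preserving maps by composition. For $S\subset X$, a subset $U\subset X$ is a *$\Delta_P$-neighborhood* of $S$ if, for every flag $\mathcal J$ of $P$ and every stratum-preserving map $\sigma\colon|\Delta^{\mathcal J}|_s\to\mathcal X$, the set $\sigma^{-1}(U)$ is a neighborhood of $\sigma^{-1}(S)$ in $|\Delta^{\mathcal J}|$. A *strata-neighborhood system* on $\mathcal X$ is a family $(U(p))_{p\in P}$ of subsets of $X$ such that, for each $p\in P$, $U(p)$ is a $\Delta_P$-neighborhood of $X_p$ and $X_{\le p}\subset U(p)$. **Proposition.** Let $\mathcal X$ be a $P$-stratified space with a strata-neighborhood system $(U(p))_{p\in P}$, and let $\mathcal I=[p_0<\dots<p_n]$ be a regular flag of $P$. Let $\mathcal U(\mathcal I)$ be the subspace $\bigcap_{p\in\mathcal I}U(p)$ of $X$ with the restricted stratification. Then the inclusion $\mathcal U(\mathcal I)\hookrightarrow\mathcal X$ induces a weak homotopy equivalence $$\mathrm{HoLink}_{\mathcal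 I}(\mathcal U(\mathcal I))\longrightarrow\mathrm{HoLink}_{\mathcal I}(\mathcal X),$$ i.e. a continuous map that is bijective on path components and on $\pi_k$ for all $k\ge1$ and all base points. -/

import Mathlib

open Topology

universe u v w

noncomputable section

/-! ### Weak homotopy equivalences -/

/-- The map on path components induced by a continuous map. -/
def zerothHomotopyMap {A : Type u} {B : Type v} [TopologicalSpace A] [TopologicalSpace B]
    (f : C(A, B)) : ZerothHomotopy A → ZerothHomotopy B :=
  ZerothHomotopy.lift (fun a => ZerothHomotopy.mk (f a))
    (fun _ _ γ => ZerothHomotopy.sound (γ.map f.continuous))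

/-- Composition of a generalized loop with a continuous map. -/
def genLoopMap {A : Type u} {B : Type v} [TopologicalSpace A] [TopologicalSpace B]
    (N : Type w) (f : C(A, B)) (a : A) (γ : GenLoop N A a) : GenLoop N B (f a) :=
  ⟨f.comp γ.1, fun y hy => congrArg f (γ.2 y hy)⟩

/-- The map on homotopy groups induced by a continuous map. -/
def homotopyGroupMap {A : Type u} {B : Type v} [TopologicalSpace A] [TopologicalSpace B]
    (N : Type w) (f : C(A, B)) (a : A) : HomotopyGroup N A a → HomotopyGroup N B (f a) :=
  Quotient.map (genLoopMap N f a) (fun _ _ h => h.map fun H => H.compContinuousMap f)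

/-- A weak homotopy equivalence: a continuous map inducing a bijection on path components and
bijections on all homotopy groups at all base points. -/
def IsWeakHomotopyEquiv {A : Type u} {B : Type v} [TopologicalSpace A] [TopologicalSpace B]
    (f : C(A, B)) : Prop :=
  Function.Bijective (zerothHomotopyMap f) ∧
    ∀ n : ℕ, 1 ≤ n → ∀ a : A, Function.Bijective (homotopyGroupMap (Fin n) f a)

/-! ### Three categories of topological spaces -/

/-- The three admissible choices of a category of topological spaces. -/
inductive SpaceCategory : Type
  | general
  | compactlyGenerated
  | deltaGenerated

namespace SpaceCategory

/-- The spaces belonging to the chosen category. -/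
def Contains (c : SpaceCategory) (X : Type u) [TopologicalSpace X] : Prop :=
  match c with
  | general => True
  | compactlyGenerated => CompactlyGeneratedSpace X
  | deltaGenerated => DeltaGeneratedSpace X

/-- The coreflection of `X` into the chosen category: the set `X` with the final topology with
respect to all continuous maps to `X` from, respectively, all spaces (this is the given topology),
compact Hausdorff spaces, and Euclidean spaces. Subspaces and mapping spaces in the chosen category
are obtained by applying it to the usual topology. -/
@[nolint unusedArguments]
def Coreflection (_c : SpaceCategory) (X : Type u) [TopologicalSpace X] : Type u := X

instance (c : SpaceCategory) (X : Type u) [t : TopologicalSpace X] :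
    TopologicalSpace (c.Coreflection X) :=
  match c with
  | general => t
  | compactlyGenerated => TopologicalSpace.compactlyGenerated.{u} X
  | deltaGenerated => TopologicalSpace.generatedBy (fun n : ℕ => Fin n → ℝ) (Y := X)

/-- The identity map from the coreflection of `X` to `X`. -/
def counit (c : SpaceCategory) (X : Type u) [TopologicalSpace X] (x : c.Coreflection X) : X := x

/-- The identity map from `X` to its coreflection. -/
def toCoreflection (c : SpaceCategory) {X : Type u} [TopologicalSpace X] (x : X) :
    c.Coreflection X := x

theorem continuous_counit (c : SpaceCategory) (X : Type u) [TopologicalSpace X] :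
    Continuous (c.counit X) := by
  cases c with
  | general => exact continuous_id
  | compactlyGenerated =>
    exact continuous_from_compactlyGenerated (X := X) (Y := X) id fun _ g => g.continuous
  | deltaGenerated =>
    exact WithGeneratedByTopology.continuous_equiv (X := fun n : ℕ => Fin n → ℝ) (Y := X)

/-- Continuous maps from compact Hausdorff spaces lift to the compactly generated coreflection. -/
theorem continuous_toCoreflection_comp {S : CompHaus.{u}} {X : Type u} [TopologicalSpace X]
    (g : C(S, X)) : Continuous fun s => toCoreflection compactlyGenerated (g s) := by
  let F : (Σ i : (S : CompHaus.{u}) × C(S, X), i.1) → compactlyGenerated.Coreflection X :=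
    fun x => x.1.2 x.2
  have hF : Continuous F := continuous_coinduced_rng
  exact hF.comp (continuous_sigmaMk (i := (⟨S, g⟩ : (S : CompHaus.{u}) × C(S, X))))

/-- Coreflection is functorial. -/
theorem continuous_coreflection (c : SpaceCategory) {X : Type u} {Y : Type u}
    [TopologicalSpace X] [TopologicalSpace Y] {f : X → Y} (hf : Continuous f) :
    Continuous fun x : c.Coreflection X => c.toCoreflection (f (c.counit X x)) := by
  cases c with
  | general => exact hf
  | compactlyGenerated =>
    exact continuous_from_compactlyGenerated (X := X) (Y := compactlyGenerated.Coreflection Y) _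
      fun S g => continuous_toCoreflection_comp ((⟨f, hf⟩ : C(X, Y)).comp g)
  | deltaGenerated =>
    refine (WithGeneratedByTopology.continuous_from_iff (X := fun n : ℕ => Fin n → ℝ) (Y := X)
      (Z := deltaGenerated.Coreflection Y) _).2 fun n g => ?_
    exact (IsGeneratedBy.equiv_symm_comp_continuous_iff (X := fun n : ℕ => Fin n → ℝ) _).2
      (hf.comp g.continuous)

/-- The coreflection of a space belongs to the chosen category. -/
theorem contains_coreflection (c : SpaceCategory) (X : Type u) [TopologicalSpace X] :
    c.Contains (c.Coreflection X) := by
  cases c with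
  | general => trivial
  | compactlyGenerated =>
    refine ⟨continuous_id_iff_le.1 ?_⟩
    exact continuous_from_compactlyGenerated (X := X)
      (Y := compactlyGenerated.Coreflection (compactlyGenerated.Coreflection X)) _
      fun S g => continuous_toCoreflection_comp ⟨_, continuous_toCoreflection_comp g⟩
  | deltaGenerated =>
    exact inferInstanceAs (DeltaGeneratedSpace (DeltaGeneratedSpace.of (Y := X)))

end SpaceCategory

/-! ### Stratified spaces -/

/-- A stratified space over the poset `P`: an object `X` of the chosen category of spaces with a
continuous map to `P`, where `P` has the Alexandrov topology whose closed sets are the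
downward closed sets. -/
structure StratifiedSpace (c : SpaceCategory) (P : Type v) [PartialOrder P] where
  carrier : Type u
  [top : TopologicalSpace carrier]
  contains : c.Contains carrier
  strat : carrier → P
  continuous_strat : Continuous fun x => WithUpperSet.toUpperSet (strat x)

attribute [instance] StratifiedSpace.top

namespace StratifiedSpace

variable {c : SpaceCategory} {P : Type v} [PartialOrder P]

/-- The `p`-stratum of `X`. -/
def stratum (X : StratifiedSpace.{u} c P) (p : P) : Set X.carrier := {x | X.strat x = p}

/-- The union of the strata of index at most `p`. -/
def lowerStrata (X : StratifiedSpace.{u} c P) (p : P) : Set X.carrier := {x | X.strat x ≤ p}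

/-- A subset of `X`, as a subspace in the chosen category, with the inherited stratification. -/
def restrict (X : StratifiedSpace.{u} c P) (A : Set X.carrier) : StratifiedSpace.{u} c P where
  carrier := c.Coreflection A
  contains := c.contains_coreflection A
  strat a := X.strat (c.counit A a)
  continuous_strat :=
    X.continuous_strat.comp (continuous_subtype_val.comp (c.continuous_counit A))

/-- A stratum-preserving map. -/
structure Hom (X Y : StratifiedSpace.{u} c P) where
  toMap : C(X.carrier, Y.carrier)
  strat_eq : ∀ x, Y.strat (toMap x) = X.strat x

/-- The inclusion of a subset. -/
def inclusion (X : StratifiedSpace.{u} c P) (A : Set X.carrier) : Hom (X.restrict A) X where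
  toMap := ⟨fun a => (c.counit A a : X.carrier),
    continuous_subtype_val.comp (c.continuous_counit A)⟩
  strat_eq := fun _ => rfl

end StratifiedSpace

/-! ### Stratified simplices

A flag `p₀ ≤ ⋯ ≤ pₙ` of `P` is a monotone map `J : Fin (n + 1) →o P`; it is regular if `J` is
injective. -/

variable {c : SpaceCategory} {P : Type v} [PartialOrder P]

theorem simplex_support_nonempty {n : ℕ} (x : stdSimplex ℝ (Fin (n + 1))) :
    (Finset.univ.filter fun i => 0 < x.1 i).Nonempty := by
  obtain ⟨i, -, hi⟩ := Finset.exists_lt_of_sum_lt (s := Finset.univ)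
    (f := fun _ : Fin (n + 1) => (0 : ℝ)) (g := x.1) (by rw [x.2.2]; simp)
  exact ⟨i, by simpa using hi⟩

/-- The stratification `x ↦ sup {pᵢ | xᵢ > 0}` of the realization of the simplex of a flag. -/
def simplexStrat {n : ℕ} (J : Fin (n + 1) →o P) (x : stdSimplex ℝ (Fin (n + 1))) : P :=
  J ((Finset.univ.filter fun i => 0 < x.1 i).max' (simplex_support_nonempty x))

theorem isLUB_simplexStrat {n : ℕ} (J : Fin (n + 1) →o P) (x : stdSimplex ℝ (Fin (n + 1))) :
    IsLUB (J '' {i | 0 < x.1 i}) (simplexStrat J x) := by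
  refine IsGreatest.isLUB ⟨⟨_, ?_, rfl⟩, ?_⟩
  · simpa using Finset.max'_mem _ (simplex_support_nonempty x)
  · rintro _ ⟨i, hi, rfl⟩
    exact J.monotone (Finset.le_max' _ _ (by simpa using hi))

/-- The stratum-preserving maps from the realization of the simplex of `J` to `X`, with the
subspace topology of the compact-open topology. -/
abbrev StratifiedSimplex {n : ℕ} (J : Fin (n + 1) →o P) (X : StratifiedSpace.{u} c P) : Type u :=
  {σ : C(stdSimplex ℝ (Fin (n + 1)), X.carrier) // ∀ x, X.strat (σ x) = simplexStrat J x}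

/-! ### Homotopy links -/

/-- The homotopy link of `X` at `I`: the set of stratum-preserving maps from the realization of the
simplex of `I` to `X`, topologized as a subspace of the mapping space in the chosen category. -/
abbrev HoLink {n : ℕ} (I : Fin (n + 1) →o P) (X : StratifiedSpace.{u} c P) : Type u :=
  c.Coreflection (StratifiedSimplex I X)

/-- Composition of a stratified simplex with a stratum-preserving map. -/
def StratifiedSimplex.map {n : ℕ} {J : Fin (n + 1) →o P} {X Y : StratifiedSpace.{u} c P}
    (f : StratifiedSpace.Hom X Y) (σ : StratifiedSimplex J X) : StratifiedSimplex J Y :=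
  ⟨f.toMap.comp σ.1, fun x => (f.strat_eq (σ.1 x)).trans (σ.2 x)⟩

/-- The map of homotopy links induced by a stratum-preserving map, by composition. -/
def HoLink.map {n : ℕ} (I : Fin (n + 1) →o P) {X Y : StratifiedSpace.{u} c P}
    (f : StratifiedSpace.Hom X Y) : C(HoLink I X, HoLink I Y) where
  toFun σ := c.toCoreflection (StratifiedSimplex.map f (c.counit _ σ))
  continuous_toFun := c.continuous_coreflection (Continuous.subtype_mk
    ((ContinuousMap.continuous_postcomp f.toMap).comp continuous_subtype_val) _)

/-! ### Strata-neighborhood systems -/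

/-- `U` is a `Δ_P`-neighborhood of `S` in `X`: for every flag `J` and every stratum-preserving map
`σ` from the realization of the simplex of `J`, the preimage of `U` is a neighborhood of the
preimage of `S`. -/
def IsDeltaNhd (X : StratifiedSpace.{u} c P) (S U : Set X.carrier) : Prop :=
  ∀ (n : ℕ) (J : Fin (n + 1) →o P) (σ : StratifiedSimplex J X), σ.1 ⁻¹' U ∈ 𝓝ˢ (σ.1 ⁻¹' S)

/-- A strata-neighborhood system on `X`. -/
structure StrataNhdSystem (X : StratifiedSpace.{u} c P) where
  nhd : P → Set X.carrier
  isDeltaNhd : ∀ p, IsDeltaNhd X (X.stratum p) (nhd p)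
  lowerStrata_subset : ∀ p, X.lowerStrata p ⊆ nhd p

/-- The intersection of the neighborhoods `U(p)` over the elements `p` of the flag `I`. -/
def StrataNhdSystem.inter {X : StratifiedSpace.{u} c P} (U : StrataNhdSystem X) {n : ℕ}
    (I : Fin (n + 1) →o P) : Set X.carrier :=
  ⋂ i, U.nhd (I i)

end

/-! Precomposing a point of the homotopy link with a strata-preserving self-map of the simplex stays
in the link and does not enlarge the image. So for a family `G : K × Δⁿ → X` with `K` the image of a
simplex, it suffices to find one deformation of `Δⁿ` through such self-maps whose end carries all
members into every `U(p_i)`.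

Let `V i` be the set of points that all members send into `U(p_i)`. It contains the face on the
vertices up to `i`, because `X_{≤ p} ⊂ U(p)`. It is a neighborhood of each point whose top vertex is
`i`: `K × Δⁿ` is itself the image of a stratified simplex, so the `Δ_P`-condition applies, and a
tube argument makes it uniform over `K` (`IsDeltaNhd.forall_mem_nhds`). Shrinking the weight above
each vertex in turn pushes `Δⁿ` into all the `V i` (`stdSimplex.exists_self_map`,
`stdSimplex.exists_deformation`).

The resulting compression keeps boundary data in the range of the map but does not fix it.
`IsCompressible.exists_collared_compression` repairs this with a collar, which gives the bijections
on path components and homotopy groups. -/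

section

open scoped unitInterval

/-! ### Convex combinations, tails and truncations in a simplex -/

namespace stdSimplex

variable {ι : Type*} [Fintype ι]

/-- The convex combination `(1 - t) x + t y` of two points of a simplex. -/
def combo (t : I) (x y : stdSimplex ℝ ι) : stdSimplex ℝ ι :=
  ⟨fun i => (1 - t) * x i + t * y i,
    fun i => add_nonneg (mul_nonneg (sub_nonneg.2 t.2.2) (x.2.1 i)) (mul_nonneg t.2.1 (y.2.1 i)),
    by simp [Finset.sum_add_distrib, ← Finset.mul_sum]⟩

theorem combo_apply (t : I) (x y : stdSimplex ℝ ι) (i : ι) :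
    combo t x y i = (1 - t) * x i + t * y i := rfl

theorem combo_self (t : I) (x : stdSimplex ℝ ι) : combo t x x = x := by
  ext i; rw [combo_apply]; ring

theorem combo_zero (x y : stdSimplex ℝ ι) : combo 0 x y = x := by
  ext i; simp [combo_apply]

theorem combo_one (x y : stdSimplex ℝ ι) : combo 1 x y = y := by
  ext i; simp [combo_apply]

theorem continuous_coord (i : ι) : Continuous fun x : stdSimplex ℝ ι => x i :=
  (continuous_apply i).comp continuous_subtype_val

theorem continuous_combo {A : Type*} [TopologicalSpace A] {t : A → I} {x y : A → stdSimplex ℝ ι}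
    (ht : Continuous t) (hx : Continuous x) (hy : Continuous y) :
    Continuous fun a => combo (t a) (x a) (y a) := by
  refine Continuous.subtype_mk (continuous_pi fun i => ?_) _
  have h1 := (continuous_coord i).comp hx
  have h2 := (continuous_coord i).comp hy
  have h3 : Continuous fun a => (t a : ℝ) := continuous_subtype_val.comp ht
  exact ((continuous_const.sub h3).mul h1).add (h3.mul h2)

theorem map_apply_eq_sum {κ : Type*} [Fintype κ] [DecidableEq κ] (f : ι → κ)
    (x : stdSimplex ℝ ι) (j : κ) : map f x j = ∑ i with f i = j, x i := by
  rw [map_coe, FunOnFinite.linearMap_apply_apply]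

theorem map_combo {κ : Type*} [Fintype κ] (f : ι → κ) (t : I) (x y : stdSimplex ℝ ι) :
    map f (combo t x y) = combo t (map f x) (map f y) := by
  classical
  ext j
  simp only [combo_apply, map_apply_eq_sum, Finset.sum_add_distrib, Finset.mul_sum]

theorem map_apply_pos_iff {κ : Type*} [Fintype κ] (f : ι → κ) (x : stdSimplex ℝ ι) (j : κ) :
    0 < map f x j ↔ ∃ i, f i = j ∧ 0 < x i := by
  classical
  rw [map_apply_eq_sum, Finset.sum_pos_iff_of_nonneg fun i _ => zero_le x i]
  simp

variable {n : ℕ}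

/-- The sum of the coordinates of index at least `k`. -/
def tail (x : stdSimplex ℝ (Fin (n + 1))) (k : ℕ) : ℝ := ∑ i with k ≤ i.val, x i

theorem tail_nonneg (x : stdSimplex ℝ (Fin (n + 1))) (k : ℕ) : 0 ≤ tail x k :=
  Finset.sum_nonneg fun i _ => x.2.1 i

theorem tail_le_one (x : stdSimplex ℝ (Fin (n + 1))) (k : ℕ) : tail x k ≤ 1 := by
  rw [← sum_eq_one x]
  exact Finset.sum_le_sum_of_subset_of_nonneg (Finset.subset_univ _) fun i _ _ => x.2.1 i

theorem apply_le_tail (x : stdSimplex ℝ (Fin (n + 1))) {k : ℕ} {i : Fin (n + 1)} (h : k ≤ i) :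
    x i ≤ tail x k :=
  Finset.single_le_sum (f := fun i => x i) (fun i _ => x.2.1 i) (by simpa using h)

theorem tail_pos_iff (x : stdSimplex ℝ (Fin (n + 1))) (k : ℕ) :
    0 < tail x k ↔ ∃ i : Fin (n + 1), k ≤ i ∧ 0 < x i := by
  rw [tail, Finset.sum_pos_iff_of_nonneg fun i _ => zero_le x i]
  simp

theorem tail_eq_add (x : stdSimplex ℝ (Fin (n + 1))) (k : Fin (n + 1)) :
    tail x k = x k + tail x (k + 1) := by
  have : (Finset.univ.filter fun i : Fin (n + 1) => k.val ≤ i.val) =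
      insert k (Finset.univ.filter fun i : Fin (n + 1) => k.val + 1 ≤ i.val) := by
    ext i; simp [Fin.ext_iff]; omega
  rw [tail, this, Finset.sum_insert (by simp)]
  rfl

theorem tail_combo (t : I) (x y : stdSimplex ℝ (Fin (n + 1))) (k : ℕ) :
    tail (combo t x y) k = (1 - t) * tail x k + t * tail y k := by
  simp only [tail, combo_apply, Finset.sum_add_distrib, Finset.mul_sum]

theorem tail_map (f : Fin (n + 1) → Fin (n + 1)) (x : stdSimplex ℝ (Fin (n + 1))) (k : ℕ) :
    tail (map f x) k = ∑ i with k ≤ (f i).val, x i := by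
  simp only [tail, map_apply_eq_sum, Finset.sum_filter]
  simp_rw [← Finset.sum_filter, Finset.sum_filter (fun _ => _ = _)]
  rw [Finset.sum_comm]
  rw [Finset.sum_filter]
  refine Finset.sum_congr rfl fun i _ => ?_
  rw [Finset.sum_ite_eq]
  simp

/-- The point of the front `k`-face obtained by moving all the weight of higher vertices to the
vertex `k`. -/
noncomputable def trunc (k : Fin (n + 1)) (x : stdSimplex ℝ (Fin (n + 1))) : stdSimplex ℝ (Fin (n + 1)) :=
  map (fun i => min i k) x

theorem continuous_trunc (k : Fin (n + 1)) :
    Continuous (trunc k : stdSimplex ℝ (Fin (n + 1)) → _) :=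
  continuous_map _

theorem trunc_combo (k : Fin (n + 1)) (t : I) (x y : stdSimplex ℝ (Fin (n + 1))) :
    trunc k (combo t x y) = combo t (trunc k x) (trunc k y) :=
  map_combo _ t x y

theorem trunc_trunc {k l : Fin (n + 1)} (h : k ≤ l) (x : stdSimplex ℝ (Fin (n + 1))) :
    trunc k (trunc l x) = trunc k x := by
  rw [trunc, trunc, map_comp_apply]
  congr 1
  ext i
  simp [min_assoc, min_eq_right h]

theorem tail_trunc_of_le {k : Fin (n + 1)} {j : ℕ} (h : j ≤ k) (x : stdSimplex ℝ (Fin (n + 1))) :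
    tail (trunc k x) j = tail x j := by
  rw [trunc, tail_map, tail]
  congr 1
  ext i
  simp [h]

theorem tail_trunc_of_lt {k : Fin (n + 1)} {j : ℕ} (h : k < j) (x : stdSimplex ℝ (Fin (n + 1))) :
    tail (trunc k x) j = 0 := by
  rw [trunc, tail_map]
  refine Finset.sum_eq_zero fun i hi => ?_
  simp at hi
  omega

/-- In the sup metric only single coordinates count: those below `k` are unchanged, the `k`-th gains
exactly the tail above `k`, and each later one loses at most that tail. -/
theorem dist_trunc_le (k : Fin (n + 1)) (x : stdSimplex ℝ (Fin (n + 1))) :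
    dist x (trunc k x) ≤ tail x (k + 1) := by
  have h0 := tail_nonneg x (k + 1)
  refine (dist_pi_le_iff h0).2 fun j => ?_
  change dist (x j) (trunc k x j) ≤ _
  have e1 := tail_eq_add x j
  have e2 := tail_eq_add (trunc k x) j
  rw [Real.dist_eq]
  rcases lt_trichotomy j k with h | h | h
  · rw [tail_trunc_of_le (by omega), tail_trunc_of_le (by omega)] at e2
    rw [show x j - trunc k x j = 0 by linarith]
    simpa
  · subst h
    rw [tail_trunc_of_le le_rfl, tail_trunc_of_lt (by simp)] at e2
    rw [abs_le]; constructor <;> linarith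
  · rw [tail_trunc_of_lt h, tail_trunc_of_lt (by omega)] at e2
    have := apply_le_tail x (k := k + 1) (i := j) (by omega)
    have := x.2.1 j
    rw [show trunc k x j = 0 by linarith, sub_zero, abs_of_nonneg (zero_le x j)]
    assumption

/-- The largest index of a vertex with positive weight. -/
noncomputable def top (x : stdSimplex ℝ (Fin (n + 1))) : Fin (n + 1) :=
  (Finset.univ.filter fun i => 0 < x.1 i).max' (simplex_support_nonempty x)

/-- This turns questions about strata into positivity of tails, which are affine in the point and so
behave well under `combo`. -/
theorem le_top_iff (x : stdSimplex ℝ (Fin (n + 1))) (k : Fin (n + 1)) :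
    k ≤ top x ↔ 0 < tail x k := by
  rw [tail_pos_iff]
  refine ⟨fun h => ⟨top x, h, ?_⟩, fun ⟨i, hi, h⟩ => le_trans (Fin.val_fin_le.1 hi) ?_⟩
  · exact (Finset.mem_filter.1 (Finset.max'_mem _ (simplex_support_nonempty x))).2
  · exact Finset.le_max' (Finset.univ.filter fun i => 0 < x.1 i) i
      (Finset.mem_filter.2 ⟨Finset.mem_univ _, h⟩)

theorem top_eq_of_tail_pos_iff {x y : stdSimplex ℝ (Fin (n + 1))}
    (h : ∀ k, 0 < tail x k ↔ 0 < tail y k) : top x = top y :=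
  eq_of_forall_le_iff fun k => by rw [le_top_iff, le_top_iff, h]

theorem top_trunc {k : Fin (n + 1)} {x : stdSimplex ℝ (Fin (n + 1))} (h : 0 < tail x k) :
    top (trunc k x) = k := by
  refine eq_of_forall_le_iff fun j => ?_
  rw [le_top_iff]
  rcases le_or_gt j k with hj | hj
  · rw [tail_trunc_of_le hj, ← le_top_iff]
    simpa [hj] using hj.trans ((le_top_iff x k).2 h)
  · rw [tail_trunc_of_lt hj]
    simp [hj]

end stdSimplex

/-- A subset of a metric space contains balls of continuously varying radius, positive at the
points of which it is a neighborhood. -/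
theorem exists_continuous_radius {M : Type*} [PseudoMetricSpace M] (V : Set M) :
    ∃ D : C(M, I), (∀ x, V ∈ 𝓝 x → 0 < D x) ∧ ∀ x y, dist y x < D x → y ∈ V := by
  -- `Metric.infDist` to the empty set is `0` by convention, so this case needs its own radius.
  rcases Set.eq_empty_or_nonempty Vᶜ with hV | hV
  · rw [Set.compl_empty_iff] at hV
    exact ⟨ContinuousMap.const _ 1, by simp, by simp [hV]⟩
  · refine ⟨⟨fun x => ⟨min 1 (Metric.infDist x Vᶜ), le_min zero_le_one Metric.infDist_nonneg,
      min_le_left _ _⟩, ?_⟩, fun x hx => ?_, fun x y hy => ?_⟩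
    · exact Continuous.subtype_mk (continuous_const.min (Metric.continuous_infDist_pt _)) _
    · refine Subtype.coe_lt_coe.1 (lt_min zero_lt_one ?_)
      rw [← Metric.infDist_closure]
      refine (isClosed_closure.notMem_iff_infDist_pos hV.closure).1 ?_
      rw [closure_compl, Set.notMem_compl_iff]
      exact mem_interior_iff_mem_nhds.2 hx
    · by_contra h
      have h1 : Metric.infDist x Vᶜ ≤ dist x y := Metric.infDist_le_dist_of_mem h
      have h2 : dist y x < min 1 (Metric.infDist x Vᶜ) := hy
      rw [dist_comm] at h2
      exact absurd (h2.trans_le (min_le_right _ _)) (not_lt.2 h1)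

/-! ### Deforming a simplex into neighborhoods of its strata -/

namespace stdSimplex

variable {n : ℕ}

/-- Induction over the vertices. Stage `m` multiplies the weight above vertex `m` by a small factor
and moves the rest of it to `m`. This changes neither the tails at indices up to `m` nor the
truncations at vertices up to `m`, so the bounds already achieved survive. The factor vanishes only
where there is no weight to scale, so strata are preserved. -/
theorem exists_self_map (D : Fin (n + 1) → C(stdSimplex ℝ (Fin (n + 1)), I))
    (hD : ∀ x, 0 < D (top x) x) (m : ℕ) :
    ∃ ψ : C(stdSimplex ℝ (Fin (n + 1)), stdSimplex ℝ (Fin (n + 1))),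
      (∀ x k, 0 < tail (ψ x) k ↔ 0 < tail x k) ∧
      ∀ x (i : Fin (n + 1)), i.val < m → 0 < tail x i →
        tail (ψ x) (i + 1) < D i (trunc i (ψ x)) := by
  induction m with
  | zero => exact ⟨ContinuousMap.id _, fun _ _ => Iff.rfl, by simp⟩
  | succ m ih =>
    obtain ⟨ψ, hψ, hψ'⟩ := ih
    rcases Nat.lt_or_ge m (n + 1) with hm | hm
    swap
    · exact ⟨ψ, hψ, fun x i _ => hψ' x i (by omega)⟩
    let l : Fin (n + 1) := ⟨m, hm⟩
    let half : I := ⟨1 / 2, by norm_num, by norm_num⟩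
    -- The radius is read off at the truncation, which this stage does not move. The factor `1 / 2`
    -- makes the final bound strict, since tails are at most `1`.
    let t : stdSimplex ℝ (Fin (n + 1)) → I := fun x => half * D l (trunc l (ψ x))
    have ht : Continuous t :=
      continuous_const.mul ((D l).continuous.comp ((continuous_trunc l).comp ψ.continuous))
    have htv (x) : (t x : ℝ) = 1 / 2 * D l (trunc l (ψ x)) := rfl
    have ht0 (x) : (0 : ℝ) ≤ t x := (t x).2.1
    have htpos (x) (h : 0 < tail x m) : 0 < (D l (trunc l (ψ x)) : ℝ) := by
      have h' : 0 < tail (ψ x) l := (hψ x m).2 h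
      have := hD (trunc l (ψ x))
      rwa [top_trunc h'] at this
    refine ⟨⟨fun x => combo (t x) (trunc l (ψ x)) (ψ x),
      continuous_combo ht ((continuous_trunc l).comp ψ.continuous) ψ.continuous⟩, fun x k => ?_,
      fun x i hi hx => ?_⟩
    · simp only [ContinuousMap.coe_mk]
      rw [tail_combo, ← hψ x k]
      rcases le_or_gt k m with hk | hk
      · rw [tail_trunc_of_le hk, ← add_mul]; simp
      · rw [tail_trunc_of_lt hk, mul_zero, zero_add]
        refine ⟨fun h => pos_of_mul_pos_right h (ht0 x), fun h => mul_pos ?_ h⟩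
        rw [htv]
        refine mul_pos (by norm_num) (htpos x ?_)
        -- Weight above `m` is in particular weight at or above `m`, so the truncation has top
        -- vertex `m` and the radius there is positive.
        rw [← hψ, tail_pos_iff]
        obtain ⟨i, hi, h'⟩ := (tail_pos_iff _ _).1 h
        exact ⟨i, by omega, h'⟩
    · simp only [ContinuousMap.coe_mk]
      have hil : i ≤ l := Nat.lt_succ_iff.1 hi
      rw [tail_combo, trunc_combo, trunc_trunc hil, combo_self]
      rcases hil.lt_or_eq with h | h
      · rw [tail_trunc_of_le (Nat.succ_le_of_lt h), ← add_mul]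
        simpa using hψ' x i h hx
      · subst h
        rw [tail_trunc_of_lt (Nat.lt_succ_self _), mul_zero, zero_add, htv]
        have h1 := htpos x hx
        have h2 := tail_le_one (ψ x) (l + 1)
        have h3 := tail_nonneg (ψ x) (l + 1)
        nlinarith

/-- A simplex can be deformed into an intersection of neighborhoods of its strata, through
self-maps that preserve the strata. -/
theorem exists_deformation (V : Fin (n + 1) → Set (stdSimplex ℝ (Fin (n + 1))))
    (hV : ∀ i x, top x ≤ i → x ∈ V i) (hV' : ∀ x, V (top x) ∈ 𝓝 x) :
    ∃ φ : C(I × stdSimplex ℝ (Fin (n + 1)), stdSimplex ℝ (Fin (n + 1))),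
      (∀ x, φ (0, x) = x) ∧ (∀ p, top (φ p) = top p.2) ∧ ∀ x i, φ (1, x) ∈ V i := by
  choose D hD hD' using fun i => exists_continuous_radius (V i)
  obtain ⟨ψ, hψ, hψ'⟩ := exists_self_map D (fun x => hD _ _ (hV' x)) (n + 1)
  refine ⟨⟨fun p => combo p.1 p.2 (ψ p.2), continuous_combo continuous_fst continuous_snd
    (ψ.continuous.comp continuous_snd)⟩, fun x => combo_zero _ _, fun p => ?_, fun x i => ?_⟩
  · refine top_eq_of_tail_pos_iff fun k => ?_
    simp only [ContinuousMap.coe_mk]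
    rw [tail_combo]
    have h1 := p.1.2.1
    have h2 := p.1.2.2
    have h := hψ p.2 k
    have h3 := tail_nonneg p.2 k
    have h4 := tail_nonneg (ψ p.2) k
    constructor
    · intro h5
      by_contra h6
      have h7 : tail p.2 k = 0 := le_antisymm (not_lt.1 h6) h3
      have h8 : tail (ψ p.2) k = 0 := le_antisymm (not_lt.1 (mt h.1 h6)) h4
      simp [h7, h8] at h5
    · intro h5
      have h6 := h.2 h5
      rcases h1.eq_or_lt with h7 | h7
      · simp [← h7, h5]
      · exact add_pos_of_nonneg_of_pos (mul_nonneg (by linarith) h3) (mul_pos h7 h6)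
  · simp only [ContinuousMap.coe_mk]
    rw [combo_one]
    -- If the top vertex is at least `i`, then `ψ x` lies in the ball around its `i`-th truncation.
    -- Otherwise `ψ x` lies in the face below `i`, which `V i` contains.
    by_cases h : 0 < tail x i
    · exact hD' i _ _ ((dist_trunc_le i (ψ x)).trans_lt (hψ' x i i.2 h))
    · refine hV i _ (le_of_lt ?_)
      rw [← hψ x i, ← le_top_iff] at h
      exact not_le.1 h

end stdSimplex

end

section

open scoped unitInterval

/-! ### Images of simplices -/

/-- A space that is the image of a simplex under a continuous map. -/
def IsSimplexImage (K : Type) [TopologicalSpace K] : Prop :=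
  ∃ (m : ℕ) (f : C(stdSimplex ℝ (Fin (m + 1)), K)), Function.Surjective f

/-! ### Retraction onto a simplex and products of simplices -/

namespace stdSimplex

variable {ι κ : Type*} [Fintype ι] [Fintype κ]

/-- A retraction of Euclidean space onto the simplex. -/
noncomputable def retraction {n : ℕ} (y : Fin (n + 1) → ℝ) : stdSimplex ℝ (Fin (n + 1)) :=
  -- Negative coordinates are cut off. A total below `1` is filled up evenly over the vertices; a
  -- total above `1` is normalized by division.
  ⟨fun i => (max (y i) 0 + max 0 (1 - ∑ j, max (y j) 0) / (n + 1)) / max 1 (∑ j, max (y j) 0),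
    fun i => by positivity, by
      have h : (n + 1 : ℝ) ≠ 0 := by positivity
      have h1 : (0 : ℝ) < max 1 (∑ j, max (y j) 0) := lt_max_of_lt_left one_pos
      rw [← Finset.sum_div, Finset.sum_add_distrib, div_eq_one_iff_eq h1.ne']
      simp only [Finset.sum_const, Finset.card_univ, Fintype.card_fin, nsmul_eq_mul]
      push_cast
      rw [mul_div_cancel₀ _ h, ← max_add_add_left]
      simp [max_comm]⟩

theorem continuous_retraction {n : ℕ} :
    Continuous (retraction : (Fin (n + 1) → ℝ) → stdSimplex ℝ (Fin (n + 1))) := by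
  refine Continuous.subtype_mk (continuous_pi fun i => ?_) _
  have h (y : Fin (n + 1) → ℝ) : max 1 (∑ j, max (y j) 0) ≠ 0 :=
    (lt_max_of_lt_left one_pos).ne'
  exact Continuous.div (by fun_prop) (by fun_prop) h

theorem retraction_coe {n : ℕ} (x : stdSimplex ℝ (Fin (n + 1))) : retraction x.1 = x := by
  ext i
  have h (j) : max (x.1 j) 0 = x.1 j := max_eq_left (x.2.1 j)
  change (max (x.1 i) 0 + max 0 (1 - ∑ j, max (x.1 j) 0) / (n + 1)) /
    max 1 (∑ j, max (x.1 j) 0) = x.1 i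
  simp only [h, x.2.2]
  simp

/-- Seen as probability distributions, `x` and `y` are the marginals of their product distribution.
-/
theorem exists_map_fst_map_snd (x : stdSimplex ℝ ι) (y : stdSimplex ℝ κ) :
    ∃ z : stdSimplex ℝ (ι × κ), map Prod.fst z = x ∧ map Prod.snd z = y := by
  classical
  have hx : ∑ i, x i = 1 := sum_eq_one x
  have hy : ∑ i, y i = 1 := sum_eq_one y
  refine ⟨⟨fun p => x p.1 * y p.2, fun p => mul_nonneg (zero_le x _) (zero_le y _), ?_⟩, ?_, ?_⟩
  · rw [Fintype.sum_prod_type]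
    simp [← Finset.mul_sum, hx, hy]
  · ext i
    rw [map_apply_eq_sum, Finset.sum_filter, Fintype.sum_prod_type]
    change ∑ a, ∑ b, (if a = i then x a * y b else 0) = x i
    rw [Finset.sum_eq_single i (by intro b _ hb; simp [hb]) (by simp)]
    simp [← Finset.mul_sum, hy]
  · ext i
    rw [map_apply_eq_sum, Finset.sum_filter, Fintype.sum_prod_type]
    change ∑ a, ∑ b, (if b = i then x a * y b else 0) = y i
    simp [← Finset.sum_mul, hx]

/-- The lexicographic enumeration of a product of two finite ordinals. -/
theorem exists_equiv_prod (a b : ℕ) : ∃ (N : ℕ) (e : Fin (N + 1) ≃ Fin (a + 1) × Fin (b + 1)),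
    Monotone fun i => (e i).1 := by
  have h : (a * b + a + b) + 1 = (a + 1) * (b + 1) := by ring
  refine ⟨a * b + a + b, (finCongr h).trans finProdFinEquiv.symm, fun i j hij => ?_⟩
  exact Nat.div_le_div_right (c := b + 1) hij

/-- The product of two simplices is the image of a simplex, in such a way that the first coordinate
is induced by a monotone map of vertices. -/
theorem exists_surjective_prod (a b : ℕ) : ∃ (N : ℕ) (g : Fin (N + 1) → Fin (a + 1))
    (h : Fin (N + 1) → Fin (b + 1)), Monotone g ∧
    ∀ (x : stdSimplex ℝ (Fin (a + 1))) (y : stdSimplex ℝ (Fin (b + 1))),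
      ∃ z : stdSimplex ℝ (Fin (N + 1)), map g z = x ∧ map h z = y := by
  obtain ⟨N, e, he⟩ := exists_equiv_prod a b
  refine ⟨N, fun i => (e i).1, fun i => (e i).2, he, fun x y => ?_⟩
  obtain ⟨z, hx, hy⟩ := exists_map_fst_map_snd x y
  refine ⟨map e.symm z, ?_, ?_⟩
  · rw [map_comp_apply, ← hx]
    congr 1
    ext i
    simp
  · rw [map_comp_apply, ← hy]
    congr 1
    ext i
    simp

end stdSimplex

/-! ### Closure properties and lifting to coreflections -/

namespace IsSimplexImage

open stdSimplex

variable {K L : Type} [TopologicalSpace K] [TopologicalSpace L]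

theorem compactSpace (hK : IsSimplexImage K) : CompactSpace K := by
  obtain ⟨m, f, hf⟩ := hK
  exact hf.compactSpace f.continuous

theorem stdSimplex (n : ℕ) : IsSimplexImage (stdSimplex ℝ (Fin (n + 1))) :=
  ⟨n, ContinuousMap.id _, Function.surjective_id⟩

theorem of_surjective (hK : IsSimplexImage K) (f : C(K, L)) (hf : Function.Surjective f) :
    IsSimplexImage L := by
  obtain ⟨m, g, hg⟩ := hK
  exact ⟨m, f.comp g, hf.comp hg⟩

theorem prod (hK : IsSimplexImage K) (hL : IsSimplexImage L) : IsSimplexImage (K × L) := by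
  obtain ⟨a, f, hf⟩ := hK
  obtain ⟨b, g, hg⟩ := hL
  obtain ⟨N, p, q, -, h⟩ := exists_surjective_prod a b
  refine ⟨N, (f.comp ⟨map p, continuous_map p⟩).prodMk (g.comp ⟨map q, continuous_map q⟩), ?_⟩
  rintro ⟨k, l⟩
  obtain ⟨x, rfl⟩ := hf k
  obtain ⟨y, rfl⟩ := hg l
  obtain ⟨z, rfl, rfl⟩ := h x y
  exact ⟨z, rfl⟩

theorem unitInterval : IsSimplexImage I :=
  (IsSimplexImage.stdSimplex 1).of_surjective
    ⟨stdSimplexHomeomorphUnitInterval, stdSimplexHomeomorphUnitInterval.continuous⟩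
    stdSimplexHomeomorphUnitInterval.surjective

theorem cube (n : ℕ) : IsSimplexImage (I^ Fin n) := by
  induction n with
  | zero =>
    exact (IsSimplexImage.stdSimplex 0).of_surjective (ContinuousMap.const _ finZeroElim)
      fun y => ⟨Classical.arbitrary _, Subsingleton.elim _ _⟩
  | succ n ih =>
    refine (unitInterval.prod ih).of_surjective
      ⟨fun p => Fin.cons p.1 p.2, continuous_pi (Fin.cases continuous_fst fun i =>
        (continuous_apply i).comp continuous_snd)⟩ fun y => ?_
    exact ⟨(y 0, Fin.tail y), Fin.cons_self_tail y⟩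

/-- Continuous maps from Hausdorff images of simplices lift to coreflections. -/
theorem continuous_toCoreflection [T2Space K] (hK : IsSimplexImage K) (c : SpaceCategory)
    {Y : Type u} [TopologicalSpace Y] {f : K → Y} (hf : Continuous f) :
    Continuous fun k => c.toCoreflection (f k) := by
  have := hK.compactSpace
  cases c with
  | general => exact hf
  | compactlyGenerated =>
    exact (SpaceCategory.continuous_toCoreflection_comp (S := CompHaus.of (ULift.{u} K))
      ⟨fun k => f k.down, hf.comp continuous_uliftDown⟩).comp continuous_uliftUp
  | deltaGenerated =>
    obtain ⟨m, g, hg⟩ := hK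
    -- A surjection from a compact space to a Hausdorff space is a quotient map, and so is a
    -- retraction. Hence `K` is a quotient of a Euclidean space, where continuity into the
    -- coreflection can be tested.
    have hq : IsQuotientMap fun y : Fin (m + 1) → ℝ => g (retraction y) := by
      refine (g.continuous.isClosedMap.isQuotientMap g.continuous hg).comp ?_
      exact IsQuotientMap.of_inverse (f := fun x : _root_.stdSimplex ℝ (Fin (m + 1)) => x.1)
        continuous_subtype_val continuous_retraction retraction_coe
    rw [hq.continuous_iff]
    exact (IsGeneratedBy.equiv_symm_comp_continuous_iff (X := fun n : ℕ => Fin n → ℝ) _).2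
      (hf.comp hq.continuous)

end IsSimplexImage

end

section

open scoped unitInterval

/-! ### Collars -/

/-- An expansion of `K` that preserves `S`, together with a function vanishing on `S` and equal to
`1` at all points that are not moved into `S`. -/
structure Collar {K : Type*} [TopologicalSpace K] (S : Set K) where
  expand : C(I × K, K)
  height : C(K, I)
  expand_zero : ∀ y, expand (0, y) = y
  expand_mem : ∀ t, ∀ y ∈ S, expand (t, y) ∈ S
  height_eq_zero : ∀ y ∈ S, height y = 0
  height_eq_one : ∀ y, expand (1, y) ∉ S → height y = 1

namespace Collar

/-- The collar of the endpoints of the unit interval. -/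
noncomputable def interval : Collar ({0, 1} : Set I) where
  -- Stretching about `1 / 2` by `1 + t`, clamped to the interval: at `t = 1` the two outer quarters
  -- collapse to the endpoints.
  expand := ⟨fun p => Set.projIcc 0 1 zero_le_one (1 / 2 + (1 + (p.1 : ℝ)) * (p.2 - 1 / 2)), by
    fun_prop⟩
  -- The slope `4` makes the height reach `1` exactly at `1 / 4` and `3 / 4`.
  height := ⟨fun y => Set.projIcc 0 1 zero_le_one (4 * min (y : ℝ) (1 - y)), by fun_prop⟩
  expand_zero y := by
    simp only [ContinuousMap.coe_mk, Set.Icc.coe_zero, add_zero, one_mul, add_sub_cancel]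
    exact Set.projIcc_val _ y
  expand_mem t y hy := by
    have ht := t.2.1
    rcases hy with rfl | rfl
    · exact Or.inl (Set.projIcc_of_le_left zero_le_one (by simp; nlinarith))
    · exact Or.inr (Set.projIcc_of_right_le zero_le_one (by simp; nlinarith))
  height_eq_zero y hy := by
    rcases hy with rfl | rfl
    · exact Set.projIcc_of_le_left zero_le_one (by simp)
    · exact Set.projIcc_of_le_left zero_le_one (by simp)
  height_eq_one y hy := by
    refine Set.projIcc_of_right_le zero_le_one ?_
    by_contra h
    refine hy ?_
    rw [not_le] at h
    rcases le_total (y : ℝ) (1 - y) with hy' | hy'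
    · rw [min_eq_left hy'] at h
      exact Or.inl (Set.projIcc_of_le_left zero_le_one (by simp; linarith))
    · rw [min_eq_right hy'] at h
      exact Or.inr (Set.projIcc_of_right_le zero_le_one (by simp; linarith))

theorem interval_expand_zero (t : I) : interval.expand (t, 0) = 0 :=
  Set.projIcc_of_le_left zero_le_one (by have := t.2.1; simp; nlinarith)

theorem interval_expand_one (t : I) : interval.expand (t, 1) = 1 :=
  Set.projIcc_of_right_le zero_le_one (by have := t.2.1; simp; nlinarith)

/-- The collar of the boundary of a cube. -/
noncomputable def cube (N : Type*) [Fintype N] : Collar (Cube.boundary N) where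
  expand := ⟨fun p i => interval.expand (p.1, p.2 i), by fun_prop⟩
  height := ⟨fun y => ∏ i, interval.height (y i),
    continuous_finsetProd _ fun i _ => interval.height.continuous.comp (continuous_apply i)⟩
  expand_zero y := funext fun i => interval.expand_zero (y i)
  expand_mem t y := fun ⟨i, hi⟩ => ⟨i, interval.expand_mem t _ hi⟩
  height_eq_zero y := fun ⟨i, hi⟩ =>
    Finset.prod_eq_zero (Finset.mem_univ i) (interval.height_eq_zero _ hi)
  height_eq_one y hy :=
    Finset.prod_eq_one fun i _ => interval.height_eq_one _ fun h => hy ⟨i, h⟩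

/-- The collar of the boundary of a product. -/
def prod {K L : Type*} [TopologicalSpace K] [TopologicalSpace L] {S : Set K} {T : Set L}
    (c : Collar S) (d : Collar T) : Collar {p : K × L | p.1 ∈ S ∨ p.2 ∈ T} where
  expand := ⟨fun p => (c.expand (p.1, p.2.1), d.expand (p.1, p.2.2)), by fun_prop⟩
  height := ⟨fun p => c.height p.1 * d.height p.2, by fun_prop⟩
  expand_zero p := Prod.ext (c.expand_zero p.1) (d.expand_zero p.2)
  expand_mem t p := Or.imp (c.expand_mem t p.1) (d.expand_mem t p.2)
  height_eq_zero p hp := by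
    rcases hp with hp | hp
    · exact mul_eq_zero_of_left (c.height_eq_zero _ hp) _
    · exact mul_eq_zero_of_right _ (d.height_eq_zero _ hp)
  height_eq_one p hp := by
    have h1 := c.height_eq_one p.1 fun h => hp (Or.inl h)
    have h2 := d.height_eq_one p.2 fun h => hp (Or.inr h)
    simp [h1, h2]

end Collar

/-! ### A criterion for weak homotopy equivalences -/

/-- The map `f` is injective, maps from images of simplices lift along `f` if they do so pointwise,
and maps from images of simplices can be compressed into the range of `f` by homotopies which
preserve the range of `f`. -/
structure IsCompressible {A : Type u} {B : Type v} [TopologicalSpace A] [TopologicalSpace B]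
    (f : C(A, B)) : Prop where
  injective : Function.Injective f
  exists_lift : ∀ {K : Type} [TopologicalSpace K] [T2Space K], IsSimplexImage K →
    ∀ g : C(K, B), (∀ k, g k ∈ Set.range f) → ∃ g' : C(K, A), ∀ k, f (g' k) = g k
  exists_compression : ∀ {K : Type} [TopologicalSpace K] [T2Space K], IsSimplexImage K →
    ∀ g : C(K, B), ∃ h : C(I × K, B), (∀ k, h (0, k) = g k) ∧ (∀ k, h (1, k) ∈ Set.range f) ∧
      ∀ s k, g k ∈ Set.range f → h (s, k) ∈ Set.range f

namespace IsCompressible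

variable {A : Type u} {B : Type v} [TopologicalSpace A] [TopologicalSpace B] {f : C(A, B)}

/-- The map is expanded while the compression runs only up to time `t * height`. On `S` the height
is `0`, so nothing but the expansion happens. At `t = 1`, a point moved into `S` has its value in
the range, where the compression keeps it; any other point has height `1` and is fully compressed.
-/
theorem exists_collared_compression (hf : IsCompressible f) {K : Type} [TopologicalSpace K]
    [T2Space K] (hK : IsSimplexImage K) {S : Set K} (c : Collar S) (g : C(K, B))
    (hg : ∀ y ∈ S, g y ∈ Set.range f) :
    ∃ (w : C(I × K, B)) (v : C(K, A)), (∀ y, w (0, y) = g y) ∧ (∀ y, w (1, y) = f (v y)) ∧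
      ∀ t, ∀ y ∈ S, w (t, y) = g (c.expand (t, y)) := by
  obtain ⟨h, h0, h1, h2⟩ := hf.exists_compression hK g
  let w : C(I × K, B) := ⟨fun p => h (p.1 * c.height p.2, c.expand p), by fun_prop⟩
  have hw (t y) : w (t, y) = h (t * c.height y, c.expand (t, y)) := rfl
  obtain ⟨v, hv⟩ := hf.exists_lift hK (w.comp ((ContinuousMap.const K 1).prodMk (.id K)))
    fun y => by
      change w (1, y) ∈ _
      rw [hw]
      by_cases hy : c.expand (1, y) ∈ S
      · exact h2 _ _ (hg _ hy)
      · rw [c.height_eq_one y hy, mul_one]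
        exact h1 _
  refine ⟨w, v, fun y => ?_, fun y => (hv y).symm, fun t y hy => ?_⟩
  · rw [hw, zero_mul, h0, c.expand_zero]
  · rw [hw, c.height_eq_zero y hy, mul_zero, h0]

theorem bijective_zerothHomotopyMap (hf : IsCompressible f) :
    Function.Bijective (zerothHomotopyMap f) := by
  constructor
  · intro x y
    induction x using ZerothHomotopy.rec with | mk a
    induction y using ZerothHomotopy.rec with | mk b
    intro hab
    obtain ⟨γ⟩ := Quotient.exact hab
    obtain ⟨w, v, -, h1, h2⟩ := hf.exists_collared_compression .unitInterval Collar.interval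
      γ.toContinuousMap (by
        rintro y (rfl | rfl)
        · exact ⟨a, γ.source.symm⟩
        · exact ⟨b, γ.target.symm⟩)
    refine ZerothHomotopy.sound ⟨v, hf.injective ?_, hf.injective ?_⟩
    · change f (v 0) = _
      rw [← h1, h2 _ _ (Or.inl rfl), Collar.interval_expand_zero]
      exact γ.source
    · change f (v 1) = _
      rw [← h1, h2 _ _ (Or.inr rfl), Collar.interval_expand_one]
      exact γ.target
  · intro x
    induction x using ZerothHomotopy.rec with | mk b
    -- The interval serves merely as a nonempty parameter space; the track of the parameter `0`
    -- joins `b` to the range.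
    obtain ⟨h, h0, h1, -⟩ := hf.exists_compression .unitInterval (ContinuousMap.const I b)
    obtain ⟨a, ha⟩ := h1 0
    refine ⟨ZerothHomotopy.mk a, ZerothHomotopy.sound (Path.symm (x := b)
      ⟨h.comp ((ContinuousMap.id I).prodMk (.const I 0)), h0 0, ha.symm⟩)⟩

/-- A generalized loop is homotopic to its composition with the expansion of the cube. -/
theorem homotopic_comp_expand {N : Type*} [Fintype N] {a : A} (γ : GenLoop N A a)
    (γ' : GenLoop N A a) (h : ∀ y, γ' y = γ ((Collar.cube N).expand (1, y))) :
    GenLoop.Homotopic γ γ' := by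
  refine ⟨⟨⟨γ.1.comp (Collar.cube N).expand, fun y => ?_, fun y => (h y).symm⟩, fun t y hy => ?_⟩⟩
  · exact congrArg γ.1 ((Collar.cube N).expand_zero y)
  · exact (γ.2 _ ((Collar.cube N).expand_mem t y hy)).trans (γ.2 y hy).symm

/-- Compressing a homotopy from `f ∘ γ` to `f ∘ δ`, with a collar of the whole boundary of `I × Iⁿ`,
yields a based homotopy in `A` between the expanded loops, which are homotopic to `γ` and `δ`. -/
theorem injective_homotopyGroupMap (hf : IsCompressible f) (n : ℕ) (a : A) :
    Function.Injective (homotopyGroupMap (Fin n) f a) := by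
  intro x y
  induction x using Quotient.inductionOn with | h γ
  induction y using Quotient.inductionOn with | h δ
  intro h
  obtain ⟨H⟩ := Quotient.exact h
  have hH (s y) (hy : y ∈ Cube.boundary (Fin n)) : H (s, y) = f a :=
    (H.eq_fst s hy).trans (congrArg f (γ.2 y hy))
  have hH0 (y) : H (0, y) = f (γ y) := H.apply_zero y
  have hH1 (y) : H (1, y) = f (δ y) := H.apply_one y
  let E := (Collar.cube (Fin n)).expand
  have hE (y) (hy : y ∈ Cube.boundary (Fin n)) : E (1, y) ∈ Cube.boundary (Fin n) :=
    (Collar.cube (Fin n)).expand_mem 1 y hy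
  obtain ⟨w, v, -, h1, h2⟩ := hf.exists_collared_compression
    (IsSimplexImage.unitInterval.prod (.cube n)) (Collar.interval.prod (Collar.cube (Fin n)))
    H.toContinuousMap (by
      rintro ⟨s, y⟩ ((rfl | rfl) | hy)
      · exact ⟨γ y, (hH0 y).symm⟩
      · exact ⟨δ y, (hH1 y).symm⟩
      · exact ⟨a, (hH s y hy).symm⟩)
  have hv (s y) (h : s ∈ ({0, 1} : Set I) ∨ y ∈ Cube.boundary (Fin n)) :
      f (v (s, y)) = H (Collar.interval.expand (1, s), E (1, y)) :=
    (h1 _).symm.trans (h2 1 (s, y) h)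
  have hv0 (y) : v (0, y) = γ (E (1, y)) := hf.injective <| by
    rw [hv 0 y (Or.inl (Or.inl rfl)), Collar.interval_expand_zero, hH0]
  have hv1 (y) : v (1, y) = δ (E (1, y)) := hf.injective <| by
    rw [hv 1 y (Or.inl (Or.inr rfl)), Collar.interval_expand_one, hH1]
  have hvb (s y) (hy : y ∈ Cube.boundary (Fin n)) : v (s, y) = a := hf.injective <| by
    rw [hv s y (Or.inr hy), hH _ _ (hE y hy)]
  let γ' : GenLoop (Fin n) A a := ⟨v.comp ((ContinuousMap.const _ 0).prodMk (.id _)), hvb 0⟩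
  let δ' : GenLoop (Fin n) A a := ⟨v.comp ((ContinuousMap.const _ 1).prodMk (.id _)), hvb 1⟩
  have hγδ : GenLoop.Homotopic γ' δ' :=
    ⟨⟨⟨v, fun _ => rfl, fun _ => rfl⟩, fun s y hy => (hvb s y hy).trans (hvb 0 y hy).symm⟩⟩
  exact Quotient.sound (((homotopic_comp_expand γ γ' hv0).trans hγδ).trans
    (homotopic_comp_expand δ δ' hv1).symm)

/-- On the boundary the collared compression is the loop composed with an expansion preserving the
boundary, hence constant at the base point; so it is a based homotopy. -/
theorem surjective_homotopyGroupMap (hf : IsCompressible f) (n : ℕ) (a : A) :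
    Function.Surjective (homotopyGroupMap (Fin n) f a) := by
  intro x
  induction x using Quotient.inductionOn with | h γ
  obtain ⟨w, v, h0, h1, h2⟩ := hf.exists_collared_compression (.cube n) (Collar.cube (Fin n)) γ.1
    fun y hy => ⟨a, (γ.2 y hy).symm⟩
  have hw (t y) (hy : y ∈ Cube.boundary (Fin n)) : w (t, y) = f a :=
    (h2 t y hy).trans (γ.2 _ ((Collar.cube (Fin n)).expand_mem t y hy))
  let v' : GenLoop (Fin n) A a :=
    ⟨v, fun y hy => hf.injective ((h1 y).symm.trans (hw 1 y hy))⟩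
  have hγ : GenLoop.Homotopic γ (genLoopMap (Fin n) f a v') :=
    ⟨⟨⟨w, h0, h1⟩, fun t y hy => (hw t y hy).trans (γ.2 y hy).symm⟩⟩
  exact ⟨Quotient.mk _ v', Quotient.sound hγ.symm⟩

theorem isWeakHomotopyEquiv (hf : IsCompressible f) : IsWeakHomotopyEquiv f :=
  ⟨hf.bijective_zerothHomotopyMap, fun n _ a =>
    ⟨hf.injective_homotopyGroupMap n a, hf.surjective_homotopyGroupMap n a⟩⟩

end IsCompressible

end

/-! ### Families of stratified simplices -/

section

variable {c : SpaceCategory} {P : Type v} [PartialOrder P]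

/-- Both sides are suprema of the same set. Since `g` may repeat vertices, this is where flags that
are not regular enter. -/
theorem simplexStrat_map {n m : ℕ} (J : Fin (n + 1) →o P) (g : Fin (m + 1) →o Fin (n + 1))
    (x : stdSimplex ℝ (Fin (m + 1))) :
    simplexStrat J (stdSimplex.map g x) = simplexStrat (J.comp g) x := by
  refine (isLUB_simplexStrat J _).unique ?_
  convert! isLUB_simplexStrat (J.comp g) x using 1
  ext p
  constructor
  · rintro ⟨j, hj, rfl⟩
    obtain ⟨i, rfl, hi⟩ := (stdSimplex.map_apply_pos_iff g x j).1 hj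
    exact ⟨i, hi, rfl⟩
  · rintro ⟨i, hi, rfl⟩
    exact ⟨g i, (stdSimplex.map_apply_pos_iff g x _).2 ⟨i, rfl, hi⟩, rfl⟩

/-- In a family of stratified simplices, parametrized by the image of a simplex, the points that
always lie in a given `Δ_P`-neighborhood of `S` form a neighborhood of any point that always lies
in `S`. -/
theorem IsDeltaNhd.forall_mem_nhds {X : StratifiedSpace.{u} c P} {S V : Set X.carrier}
    (h : IsDeltaNhd X S V) {n : ℕ} (I : Fin (n + 1) →o P) {K : Type} [TopologicalSpace K]
    (hK : IsSimplexImage K) (G : C(K × stdSimplex ℝ (Fin (n + 1)), X.carrier))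
    (hG : ∀ k x, X.strat (G (k, x)) = simplexStrat I x) (x : stdSimplex ℝ (Fin (n + 1)))
    (hx : ∀ k, G (k, x) ∈ S) : {y | ∀ k, G (k, y) ∈ V} ∈ 𝓝 x := by
  obtain ⟨m, f, hf⟩ := hK
  obtain ⟨N, p, q, hp, hpq⟩ := stdSimplex.exists_surjective_prod n m
  let g : Fin (N + 1) →o Fin (n + 1) := ⟨p, hp⟩
  let σ : StratifiedSimplex (I.comp g) X :=
    ⟨G.comp ((f.comp ⟨_, stdSimplex.continuous_map q⟩).prodMk ⟨_, stdSimplex.continuous_map p⟩),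
      fun z => (hG _ _).trans (simplexStrat_map I g z)⟩
  have hσ := h N (I.comp g) σ
  -- Tube lemma: the map induced by `p` is closed and its fiber over `x` is sent into `S`, so the
  -- preimage of `V` contains all fibers over some neighborhood of `x`.
  have hev := (stdSimplex.continuous_map (S := ℝ) p).isClosedMap.eventually_nhds_fiber x
    (p := fun z => σ.1 z ∈ V) fun z hz => by
      refine mem_nhdsSet_iff_forall.1 hσ z ?_
      have hz' : stdSimplex.map p z = x := hz
      change G (_, stdSimplex.map p z) ∈ S
      rw [hz']
      exact hx _
  filter_upwards [hev] with y hy k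
  obtain ⟨t, rfl⟩ := hf k
  obtain ⟨z, rfl, rfl⟩ := hpq y t
  exact hy z rfl

theorem simplexStrat_eq_top {n : ℕ} (J : Fin (n + 1) →o P) (x : stdSimplex ℝ (Fin (n + 1))) :
    simplexStrat J x = J (stdSimplex.top x) := rfl

/-! ### Compressing families in the homotopy link -/

namespace HoLink

variable {n : ℕ} {I : Fin (n + 1) →o P} {X : StratifiedSpace.{u} c P}

/-- The map underlying a point of the homotopy link. -/
def toMap (σ : HoLink I X) : C(stdSimplex ℝ (Fin (n + 1)), X.carrier) := (c.counit _ σ).1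

theorem continuous_toMap : Continuous (toMap : HoLink I X → _) :=
  continuous_subtype_val.comp (c.continuous_counit _)

theorem strat_toMap (σ : HoLink I X) (x : stdSimplex ℝ (Fin (n + 1))) :
    X.strat (toMap σ x) = simplexStrat I x := (c.counit _ σ).2 x

theorem ext_toMap {σ τ : HoLink I X} (h : ∀ x, toMap σ x = toMap τ x) : σ = τ :=
  Subtype.ext (ContinuousMap.ext h)

/-- A family of stratified simplices parametrized by the image of a simplex is a continuous map to
the homotopy link. -/
theorem exists_of_family {K : Type} [TopologicalSpace K] [T2Space K] (hK : IsSimplexImage K)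
    (G : C(K × stdSimplex ℝ (Fin (n + 1)), X.carrier))
    (hG : ∀ k x, X.strat (G (k, x)) = simplexStrat I x) :
    ∃ g : C(K, HoLink I X), ∀ k x, toMap (g k) x = G (k, x) :=
  ⟨⟨_, hK.continuous_toCoreflection c (Y := StratifiedSimplex I X)
    (f := fun k => ⟨G.curry k, hG k⟩) (G.curry.continuous.subtype_mk _)⟩, fun _ _ => rfl⟩

theorem continuous_family {K : Type*} [TopologicalSpace K] (g : C(K, HoLink I X)) :
    Continuous fun p : K × stdSimplex ℝ (Fin (n + 1)) => toMap (g p.1) p.2 :=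
  ((continuous_toMap.comp g.continuous).comp continuous_fst).eval continuous_snd

theorem mem_range_map_inclusion_iff {A : Set X.carrier} (σ : HoLink I X) :
    σ ∈ Set.range (HoLink.map I (X.inclusion A)) ↔ ∀ x, toMap σ x ∈ A := by
  constructor
  · rintro ⟨τ, rfl⟩ x
    exact (c.counit A (toMap τ x)).2
  · intro h
    have hc : Continuous fun x => c.toCoreflection (⟨toMap σ x, h x⟩ : A) :=
      (IsSimplexImage.stdSimplex n).continuous_toCoreflection c
        ((toMap σ).continuous.subtype_mk h)
    exact ⟨c.toCoreflection (X := StratifiedSimplex I (X.restrict A)) ⟨⟨_, hc⟩, strat_toMap σ⟩,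
      ext_toMap fun _ => rfl⟩

/-- The subspace has the coreflected topology, so continuity is checked for the adjoint map on `K ×
Δⁿ`, again the image of a simplex. -/
theorem exists_lift_map_inclusion {A : Set X.carrier} {K : Type} [TopologicalSpace K] [T2Space K]
    (hK : IsSimplexImage K) (g : C(K, HoLink I X)) (h : ∀ k x, toMap (g k) x ∈ A) :
    ∃ g' : C(K, HoLink I (X.restrict A)), ∀ k, HoLink.map I (X.inclusion A) (g' k) = g k := by
  have hc : Continuous fun p : K × stdSimplex ℝ (Fin (n + 1)) =>
      c.toCoreflection (⟨toMap (g p.1) p.2, h p.1 p.2⟩ : A) :=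
    (hK.prod (.stdSimplex n)).continuous_toCoreflection c
      ((continuous_family g).subtype_mk fun p => h p.1 p.2)
  obtain ⟨g', hg'⟩ := exists_of_family (I := I) (X := X.restrict A) hK ⟨_, hc⟩
    fun k x => strat_toMap (g k) x
  refine ⟨g', fun k => ext_toMap fun x => ?_⟩
  exact congrArg (fun a : (X.restrict A).carrier => (c.counit A a : X.carrier)) (hg' k x)

theorem injective_map_inclusion (A : Set X.carrier) :
    Function.Injective (HoLink.map I (X.inclusion A)) := fun σ τ h => by
  refine ext_toMap fun x => Subtype.ext ?_
  exact congrArg (fun ρ : HoLink I X => toMap ρ x) h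

/-- Families in the homotopy link can be compressed into the intersection of a strata-neighborhood
system by precomposition with self-maps of the simplex. -/
theorem exists_compression (U : StrataNhdSystem X) {K : Type} [TopologicalSpace K] [T2Space K]
    (hK : IsSimplexImage K) (g : C(K, HoLink I X)) :
    ∃ h : C(unitInterval × K, HoLink I X), (∀ k, h (0, k) = g k) ∧
      (∀ k x, toMap (h (1, k)) x ∈ U.inter I) ∧
      ∀ s k x, ∃ y, toMap (h (s, k)) x = toMap (g k) y := by
  let G : C(K × stdSimplex ℝ (Fin (n + 1)), X.carrier) := ⟨_, continuous_family g⟩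
  have hG (k x) : X.strat (G (k, x)) = simplexStrat I x := strat_toMap (g k) x
  -- The sets quantify over all of `K`, so a single `φ` works for every member of the family.
  obtain ⟨φ, h0, hφ, h1⟩ := stdSimplex.exists_deformation
    (fun i => {x | ∀ k, G (k, x) ∈ U.nhd (I i)})
    (fun i x hx k => U.lowerStrata_subset _ ((hG k x).trans_le (I.monotone hx)))
    (fun x => (U.isDeltaNhd _).forall_mem_nhds I hK G hG x fun k => hG k x)
  obtain ⟨h, hh⟩ := exists_of_family (I := I) (IsSimplexImage.unitInterval.prod hK)
    (G.comp ⟨fun p : (unitInterval × K) × stdSimplex ℝ (Fin (n + 1)) =>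
      (p.1.2, φ (p.1.1, p.2)), by fun_prop⟩) (fun k x => by
        change X.strat (G (k.2, φ (k.1, x))) = _
        rw [hG, simplexStrat_eq_top, hφ, simplexStrat_eq_top])
  have hh' (s k x) : toMap (h (s, k)) x = toMap (g k) (φ (s, x)) := hh (s, k) x
  refine ⟨h, fun k => ext_toMap fun x => by rw [hh', h0], fun k x => ?_, fun s k x => ⟨_, hh' s k x⟩⟩
  rw [hh']
  exact Set.mem_iInter.2 fun i => h1 x i k

/-- Each compressed simplex takes only values of the original one, so a simplex already in the
intersection stays there throughout. -/
theorem isCompressible_map_inclusion (U : StrataNhdSystem X) :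
    IsCompressible (HoLink.map I (X.inclusion (U.inter I))) where
  injective := injective_map_inclusion _
  exists_lift hK g hg :=
    exists_lift_map_inclusion hK g fun k => (mem_range_map_inclusion_iff _).1 (hg k)
  exists_compression hK g := by
    obtain ⟨h, h0, h1, h2⟩ := exists_compression U hK g
    refine ⟨h, h0, fun k => (mem_range_map_inclusion_iff _).2 (h1 k), fun s k hk => ?_⟩
    rw [mem_range_map_inclusion_iff] at hk ⊢
    intro x
    obtain ⟨y, hy⟩ := h2 s k x
    rw [hy]
    exact hk y

end HoLink

end

theorem mainTheorem3 {P : Type v} [PartialOrder P] (c : SpaceCategory)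
    (X : StratifiedSpace.{u} c P) (U : StrataNhdSystem X)
    {n : ℕ} (I : Fin (n + 1) →o P) (hI : Function.Injective I) :
    IsWeakHomotopyEquiv (HoLink.map I (X.inclusion (U.inter I))) :=
  (HoLink.isCompressible_map_inclusion U).isWeakHomotopyEquiv
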